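/- Theorem. For every polynomial $p$ there is a polynomial $q$ such that the following holds for every $n$. Let $H$ be a Hermitian operator on $n$ qubits, i.e. on $(\mathbb C^2)^{\otimes n}\cong\mathbb C^{2^n}$, with $0\preccurlyeq H\preccurlyeq I$, let $\eta\in\mathbb R$, and let $|\psi\rangle,|\phi\rangle\in(\mathbb C^2)^{\otimes n}$ be unit vectors with $\langle\psi|H|\psi\rangle\le\eta$ and $\langle\phi|H|\phi\rangle\le\eta$. For any real $\Delta\ge 2^{-p(n)}$ there exists a sequence $U_1,\dots,U_m$ of $2$-local unitary gates (each is a unitary acting on at most two of the qubits, not necessarily neighbouring, tensored with the identity on the remaining qubits) with $m\le 2^{q(n)}$ such that 1. $\bigl\|U_m\cdots U_1|\psi\rangle-|\phi\rangle\bigr\|_2\le\Delta$, where $\|\cdot\|_2$ is the Euclidean norm, and 2. $\langle\psi_i|H|\psi_i\rangle\le\eta+\Delta$ for all $i\in\{1,\dots,m\}$, where $|\psi_i\rangle:=U_i\cdots U_1|\psi\rangle$. -/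

import Mathlib

open scoped ComplexOrder

/-- The state space `(ℂ²)^{⊗ n}` of `n` qubits, with its Euclidean norm and inner product; the
computational basis is indexed by bit strings of length `n`. -/
abbrev QState (n : ℕ) : Type := EuclideanSpace ℂ (Fin n → Fin 2)

/-- Operators on `n` qubits, as `2^n × 2^n` matrices in the computational basis. -/
abbrev QOp (n : ℕ) : Type := Matrix (Fin n → Fin 2) (Fin n → Fin 2) ℂ

/-- The `n`-qubit operator `V ⊗ I` in which `V` acts on the qubits in `S` and the identity acts on
all the other qubits. -/
def QOp.actOn {n : ℕ} (S : Finset (Fin n)) (V : Matrix (S → Fin 2) (S → Fin 2) ℂ) : QOp n :=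
  Matrix.of fun x y =>
    if ∀ i, i ∉ S → x i = y i then V (fun i => x i) (fun i => y i) else 0

/-- `U` is a `k`-local unitary: a unitary on some set of at most `k` qubits (in any position),
tensored with the identity on the remaining qubits. -/
def QOp.IsLocalUnitary {n : ℕ} (k : ℕ) (U : QOp n) : Prop :=
  ∃ S : Finset (Fin n), S.card ≤ k ∧
    ∃ V ∈ Matrix.unitaryGroup (S → Fin 2) ℂ, U = QOp.actOn S V

/-- The state `U_m ⋯ U_1 |ψ⟩` for the list of gates `[U_1, …, U_m]`. -/
noncomputable def QState.applyGates {n : ℕ} (gates : List (QOp n)) (ψ : QState n) : QState n :=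
  gates.foldl (fun v U => Matrix.toEuclideanLin U v) ψ

/-- The energy `⟨ψ|H|ψ⟩` (a real number when `H` is Hermitian). -/
noncomputable def QState.energy {n : ℕ} (H : QOp n) (ψ : QState n) : ℝ :=
  (inner ℂ ψ (Matrix.toEuclideanLin H ψ)).re

/-!
Two states `ψ`, `φ` of energy at most `η` are joined by a short path of such states. Multiply `ψ` by a
phase that makes `⟨ψ, (H - η) φ⟩` purely imaginary; the quadratic form of `H - η` along the segment
from `ψ` to `φ` then has no cross term, so the normalized segment has energy at most `η`. The remaining
sign of the phase makes `Re ⟨ψ, φ⟩` nonnegative, which keeps the segment away from zero and the path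
Lipschitz (`exists_lowEnergy_path`).

It remains to follow this path by `2`-local gates so that all intermediate states stay close to it.
Each point of a fine discretization is carried to the next by `1 + A`, with `A` skew-Hermitian and
small, up to a quadratic error (`exists_skewHermitian_step`). The predicate `Generates` says that
`1 + t A` is, up to `O(t²)`, a product of few gates whose partial products are all near the identity.
It is stable under real linear combinations and under conjugation by a gate near the identity. If
`J² = -1` and `U = cos a + sin a • J`, then `U X U* - U* X U = sin (2 a) • (J X - X J)`, so it is also stable under
commutators with `2`-local Pauli strings `J` (`Generates.commutator`). The conjugations displace the
partial products by `O(a)` only; the price for a small `a` is the factor `1 / sin (2 a)` in the size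
of the coefficients. As `n` such commutators reach every Pauli string (`generates_pauliString`), and
Pauli strings span the skew-Hermitian operators, every step of the path can be made, with
coefficients of size `2 ^ poly(n)` when `a = 2 ^ (-poly(n))`. The errors of the steps are quadratic in
the step length, so exponentially many steps make their sum small (`exists_gates_follow`).
-/

section

open Matrix
open scoped Matrix.Norms.L2Operator

/-! ### Pauli strings -/

/-- The single-qubit Pauli matrices `I, X, Y, Z`, indexed by `0, 1, 2, 3`. -/
def pauli : Fin 4 → Matrix (Fin 2) (Fin 2) ℂ
  | 0 => 1
  | 1 => !![0, 1; 1, 0]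
  | 2 => !![0, -Complex.I; Complex.I, 0]
  | 3 => !![1, 0; 0, -1]

theorem pauli_conjTranspose (s : Fin 4) : (pauli s)ᴴ = pauli s := by
  fin_cases s <;> ext a b <;> fin_cases a <;> fin_cases b <;> simp [pauli]

theorem pauli_mul_self (s : Fin 4) : pauli s * pauli s = 1 := by
  fin_cases s <;> ext a b <;> fin_cases a <;> fin_cases b <;> simp [pauli, Matrix.mul_apply]

theorem star_pauli_apply (s : Fin 4) (a b : Fin 2) : star (pauli s a b) = pauli s b a := by
  have := congrFun (congrFun (pauli_conjTranspose s) b) a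
  simpa using this

/-- Each non-identity Pauli matrix is, up to a phase, the product of two anticommuting ones. -/
theorem exists_pauli_mul {s : Fin 4} (hs : s ≠ 0) :
    ∃ u v : Fin 4, pauli u * pauli v = Complex.I • pauli s ∧
      pauli v * pauli u = -(Complex.I • pauli s) := by
  fin_cases s
  · simp at hs
  · refine ⟨2, 3, ?_, ?_⟩ <;> ext a b <;> fin_cases a <;> fin_cases b <;>
      simp [pauli, Matrix.mul_apply]
  · refine ⟨3, 1, ?_, ?_⟩ <;> ext a b <;> fin_cases a <;> fin_cases b <;>
      simp [pauli, Matrix.mul_apply]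
  · refine ⟨1, 2, ?_, ?_⟩ <;> ext a b <;> fin_cases a <;> fin_cases b <;>
      simp [pauli, Matrix.mul_apply]

theorem sum_pauli_mul_star (a b c d : Fin 2) :
    ∑ s, pauli s a b * star (pauli s c d) = if a = c ∧ b = d then 2 else 0 := by
  fin_cases a <;> fin_cases b <;> fin_cases c <;> fin_cases d <;>
    simp [pauli, Fin.sum_univ_four] <;> norm_num

section Tensor

variable {ι : Type*} [Fintype ι]

/-- The tensor product `⨂ i, M i` of single-qubit operators. -/
def tensorOp (M : ι → Matrix (Fin 2) (Fin 2) ℂ) : Matrix (ι → Fin 2) (ι → Fin 2) ℂ :=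
  Matrix.of fun x y => ∏ i, M i (x i) (y i)

/-- The Pauli string `⨂ i, σ_{f i}`. -/
def pauliString (f : ι → Fin 4) : Matrix (ι → Fin 2) (ι → Fin 2) ℂ :=
  tensorOp fun i => pauli (f i)

theorem tensorOp_mul [DecidableEq ι] (M N : ι → Matrix (Fin 2) (Fin 2) ℂ) :
    tensorOp M * tensorOp N = tensorOp fun i => M i * N i := by
  ext x y
  simp only [tensorOp, Matrix.mul_apply, Matrix.of_apply, ← Finset.prod_mul_distrib]
  rw [Finset.prod_univ_sum, Fintype.piFinset_univ]

theorem tensorOp_one [DecidableEq ι] :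
    tensorOp (fun _ : ι => (1 : Matrix (Fin 2) (Fin 2) ℂ)) = 1 := by
  ext x y
  simp only [tensorOp, Matrix.of_apply, Matrix.one_apply, funext_iff, Finset.prod_ite_zero,
    Finset.mem_univ, forall_const, Finset.prod_const_one]

/-- A scalar on one tensor factor can be pulled out. -/
theorem tensorOp_smul_factor [DecidableEq ι] (M N : ι → Matrix (Fin 2) (Fin 2) ℂ) (j : ι) (c : ℂ)
    (hj : N j = c • M j) (h : ∀ i, i ≠ j → N i = M i) : tensorOp N = c • tensorOp M := by
  ext x y
  simp only [tensorOp, Matrix.of_apply, Matrix.smul_apply, smul_eq_mul]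
  rw [← Finset.mul_prod_erase _ _ (Finset.mem_univ j), ← Finset.mul_prod_erase _
    (fun i => M i (x i) (y i)) (Finset.mem_univ j), hj, ← mul_assoc]
  congr 1
  refine Finset.prod_congr rfl fun i hi => ?_
  rw [h i (Finset.ne_of_mem_erase hi)]

theorem pauliString_conjTranspose (f : ι → Fin 4) : (pauliString f)ᴴ = pauliString f := by
  ext x y
  simp only [pauliString, tensorOp, Matrix.conjTranspose_apply, Matrix.of_apply, star_prod,
    star_pauli_apply]

theorem pauliString_mul_self [DecidableEq ι] (f : ι → Fin 4) :
    pauliString f * pauliString f = 1 := by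
  simp only [pauliString, tensorOp_mul, pauli_mul_self, tensorOp_one]

theorem norm_pauliString_apply_le (f : ι → Fin 4) (x y : ι → Fin 2) :
    ‖pauliString f x y‖ ≤ 1 := by
  have h : ∀ (s : Fin 4) (a b : Fin 2), ‖pauli s a b‖ ≤ 1 := by
    intro s a b
    fin_cases s <;> fin_cases a <;> fin_cases b <;> simp [pauli]
  simp only [pauliString, tensorOp, Matrix.of_apply, norm_prod]
  exact Finset.prod_le_one (fun _ _ => norm_nonneg _) fun i _ => h _ _ _

/-- Completeness of the Pauli strings as an operator basis. -/
theorem sum_pauliString_mul_star [DecidableEq ι] (x y u v : ι → Fin 2) :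
    ∑ f : ι → Fin 4, pauliString f x y * star (pauliString f u v) =
      if x = u ∧ y = v then 2 ^ Fintype.card ι else 0 := by
  have h : ∀ f : ι → Fin 4, pauliString f x y * star (pauliString f u v) =
      ∏ i, pauli (f i) (x i) (y i) * star (pauli (f i) (u i) (v i)) := by
    intro f
    simp only [pauliString, tensorOp, Matrix.of_apply, star_prod, Finset.prod_mul_distrib]
  simp only [h]
  rw [← Fintype.piFinset_univ, ← Finset.prod_univ_sum (fun _ => Finset.univ)
    (fun i s => pauli s (x i) (y i) * star (pauli s (u i) (v i)))]
  simp only [sum_pauli_mul_star, Finset.prod_ite_zero, Finset.prod_const, Finset.card_univ,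
    Finset.mem_univ, forall_const, funext_iff, forall_and]

/-- A skew-Hermitian operator whose entries are at most `B` is a real combination of the operators
`i • pauliString f` with coefficients at most `2 ^ n * B`. -/
theorem exists_pauliString_expansion [DecidableEq ι] (A : Matrix (ι → Fin 2) (ι → Fin 2) ℂ)
    (hA : Aᴴ = -A) {B : ℝ} (hB : ∀ x y, ‖A x y‖ ≤ B) :
    ∃ r : (ι → Fin 4) → ℝ, (∀ f, |r f| ≤ 2 ^ Fintype.card ι * B) ∧
      A = ∑ f, r f • (Complex.I • pauliString f) := by
  set N : ℕ := Fintype.card ι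
  let c : (ι → Fin 4) → ℂ := fun f => (2 ^ N)⁻¹ * ∑ u, ∑ v, star (pauliString f u v) * A u v
  have hc : ∀ f, ‖c f‖ ≤ 2 ^ N * B := by
    intro f
    have h1 : ‖∑ u, ∑ v, star (pauliString f u v) * A u v‖ ≤
        ∑ u : ι → Fin 2, ∑ v : ι → Fin 2, B := by
      refine norm_sum_le_of_le _ fun u _ => norm_sum_le_of_le _ fun v _ => ?_
      rw [norm_mul, norm_star]
      calc _ ≤ 1 * ‖A u v‖ := by gcongr; exact norm_pauliString_apply_le f u v
        _ ≤ B := by rw [one_mul]; exact hB u v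
    have h2 : ∑ u : ι → Fin 2, ∑ v : ι → Fin 2, B = 2 ^ N * (2 ^ N * B) := by
      simp [N]
    rw [h2] at h1
    simp only [c, norm_mul, norm_inv, norm_pow, RCLike.norm_ofNat]
    rw [inv_mul_le_iff₀ (by positivity)]
    exact h1
  -- Pauli strings are Hermitian, so the coefficients of a skew-Hermitian operator are imaginary.
  have hre : ∀ f, (c f).re = 0 := by
    intro f
    have h1 : star (c f) = - c f := by
      simp only [c, star_mul', star_sum, star_star, star_inv₀, star_pow, star_ofNat]
      rw [Finset.sum_comm, ← mul_neg, ← Finset.sum_neg_distrib]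
      congr 1
      refine Finset.sum_congr rfl fun u _ => ?_
      rw [← Finset.sum_neg_distrib]
      refine Finset.sum_congr rfl fun v _ => ?_
      have h2 := congrFun (congrFun hA u) v
      have h3 := congrFun (congrFun (pauliString_conjTranspose f) u) v
      simp only [Matrix.conjTranspose_apply, Matrix.neg_apply] at h2 h3
      rw [h2, ← h3, star_star, mul_neg]
    have := congrArg Complex.re h1
    simp at this
    linarith
  refine ⟨fun f => (c f).im, fun f => (Complex.abs_im_le_norm _).trans (hc f), ?_⟩
  have hcf : ∀ f, ((c f).im : ℂ) * Complex.I = c f := by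
    intro f
    apply Complex.ext <;> simp [hre]
  ext x y
  have h4 : ∀ f, ((c f).im • (Complex.I • pauliString f)) x y = c f * pauliString f x y := by
    intro f
    rw [← hcf f]
    simp [Matrix.smul_apply, mul_assoc]
  rw [Matrix.sum_apply]
  simp only [h4, c]
  have h5 : ∀ f, (2 ^ N : ℂ)⁻¹ * (∑ u, ∑ v, star (pauliString f u v) * A u v) *
      pauliString f x y = (2 ^ N : ℂ)⁻¹ * ∑ u, ∑ v,
        (pauliString f x y * star (pauliString f u v)) * A u v := by
    intro f
    rw [mul_assoc, Finset.sum_mul]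
    congr 1
    refine Finset.sum_congr rfl fun u _ => ?_
    rw [Finset.sum_mul]
    exact Finset.sum_congr rfl fun v _ => by ring
  simp only [h5]
  rw [← Finset.mul_sum, Finset.sum_comm]
  have h6 : ∀ u : ι → Fin 2,
      ∑ f : ι → Fin 4, ∑ v, (pauliString f x y * star (pauliString f u v)) * A u v =
        ∑ v, (if x = u ∧ y = v then (2 : ℂ) ^ N else 0) * A u v := by
    intro u
    rw [Finset.sum_comm]
    refine Finset.sum_congr rfl fun v _ => ?_
    rw [← Finset.sum_mul, sum_pauliString_mul_star]
  simp only [h6, ite_mul, zero_mul, ite_and]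
  simp

/-- The rotation `cos t + sin t • i T = exp (i t T)` about the Pauli string `T`. -/
noncomputable def pauliRot [DecidableEq ι] (f : ι → Fin 4) (t : ℝ) :
    Matrix (ι → Fin 2) (ι → Fin 2) ℂ :=
  Real.cos t • 1 + Real.sin t • (Complex.I • pauliString f)

theorem star_pauliRot [DecidableEq ι] (f : ι → Fin 4) (t : ℝ) :
    star (pauliRot f t) = pauliRot f (-t) := by
  simp [pauliRot, Matrix.star_eq_conjTranspose, pauliString_conjTranspose]

theorem I_smul_pauliString_mul_self [DecidableEq ι] (f : ι → Fin 4) :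
    (Complex.I • pauliString f) * (Complex.I • pauliString f) = -1 := by
  rw [smul_mul_smul_comm, pauliString_mul_self, Complex.I_mul_I, neg_one_smul]

theorem pauliRot_mul_neg [DecidableEq ι] (f : ι → Fin 4) (t : ℝ) :
    pauliRot f t * pauliRot f (-t) = 1 := by
  have hJ := I_smul_pauliString_mul_self f
  have h1 : Real.cos t * Real.cos t + Real.sin t * Real.sin t = 1 := by
    nlinarith [Real.cos_sq_add_sin_sq t]
  simp only [pauliRot, Real.cos_neg, Real.sin_neg]
  generalize Complex.I • pauliString f = J at hJ
  calc (Real.cos t • (1 : Matrix (ι → Fin 2) (ι → Fin 2) ℂ) + Real.sin t • J) *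
        (Real.cos t • 1 + (-Real.sin t) • J)
      = (Real.cos t * Real.cos t) • 1 - (Real.sin t * Real.sin t) • (J * J) := by
        simp only [add_mul, mul_add, smul_mul_smul_comm, one_mul, mul_one]
        module
    _ = (Real.cos t * Real.cos t + Real.sin t * Real.sin t) • 1 := by
        rw [hJ]
        module
    _ = 1 := by rw [h1, one_smul]

theorem pauliRot_mem_unitary [DecidableEq ι] (f : ι → Fin 4) (t : ℝ) :
    pauliRot f t ∈ unitary (Matrix (ι → Fin 2) (ι → Fin 2) ℂ) := by
  rw [Unitary.mem_iff, star_pauliRot]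
  refine ⟨?_, pauliRot_mul_neg f t⟩
  simpa using pauliRot_mul_neg f (-t)

end Tensor

/-! ### Local gates -/

section ActOn

variable {n : ℕ} (S : Finset (Fin n))

theorem QOp.actOn_one : QOp.actOn S 1 = 1 := by
  ext x y
  simp only [QOp.actOn, Matrix.of_apply, Matrix.one_apply, funext_iff, Subtype.forall]
  rw [← ite_and]
  refine if_congr ?_ rfl rfl
  constructor
  · rintro ⟨h1, h2⟩ i
    by_cases hi : i ∈ S
    exacts [h2 i hi, h1 i hi]
  · exact fun h => ⟨fun i _ => h i, fun i _ => h i⟩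

theorem QOp.actOn_pauliString (f : Fin n → Fin 4) (hf : ∀ i, i ∉ S → f i = 0) :
    QOp.actOn S (pauliString fun i : S => f i) = pauliString f := by
  ext x y
  simp only [QOp.actOn, Matrix.of_apply, pauliString, tensorOp]
  rw [← Finset.prod_mul_prod_compl S, Finset.prod_coe_sort S
    (fun i => pauli (f i) (x i) (y i))]
  have : ∏ i ∈ Sᶜ, pauli (f i) (x i) (y i) = if ∀ i, i ∉ S → x i = y i then 1 else 0 := by
    rw [Finset.prod_congr rfl (g := fun i => if x i = y i then 1 else 0)]
    · simp [Finset.prod_ite_zero]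
    · intro i hi
      rw [hf i (by simpa using hi)]
      simp [pauli, Matrix.one_apply]
  rw [this]
  simp

theorem QOp.actOn_pauliRot (f : Fin n → Fin 4) (hf : ∀ i, i ∉ S → f i = 0) (t : ℝ) :
    QOp.actOn S (pauliRot (fun i : S => f i) t) = pauliRot f t := by
  simp only [pauliRot]
  rw [← QOp.actOn_one S, ← QOp.actOn_pauliString S f hf]
  ext x y
  simp only [QOp.actOn, Matrix.add_apply, Matrix.smul_apply, Matrix.of_apply]
  split_ifs <;> simp

end ActOn

/-- A `2`-local unitary gate. The unitarity of the full operator follows from that of its local factor,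
but is kept as a second component for direct use. -/
def IsGate {n : ℕ} (U : QOp n) : Prop :=
  QOp.IsLocalUnitary 2 U ∧ U ∈ unitary (QOp n)

theorem isGate_pauliRot {n : ℕ} (f : Fin n → Fin 4) (S : Finset (Fin n)) (hS : S.card ≤ 2)
    (hf : ∀ i, i ∉ S → f i = 0) (t : ℝ) : IsGate (pauliRot f t) :=
  ⟨⟨S, hS, _, pauliRot_mem_unitary (fun i : S => f i) t, (QOp.actOn_pauliRot S f hf t).symm⟩,
    pauliRot_mem_unitary f t⟩

theorem isGate_phase {n : ℕ} {c : ℂ} (hc : ‖c‖ = 1) : IsGate (c • (1 : QOp n)) := by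
  have h : ∀ (κ : Type) [Fintype κ] [DecidableEq κ], c • (1 : Matrix κ κ ℂ) ∈
      unitary (Matrix κ κ ℂ) := by
    intro κ _ _
    have h1 : star c * c = 1 := by
      rw [Complex.star_def, ← Complex.normSq_eq_conj_mul_self, Complex.normSq_eq_norm_sq, hc]
      simp
    rw [Unitary.mem_iff, star_smul, star_one, smul_mul_smul_comm, smul_mul_smul_comm, one_mul,
      mul_comm c, h1, one_smul]
    exact ⟨rfl, rfl⟩
  refine ⟨⟨∅, by simp, c • 1, h _, ?_⟩, h _⟩
  rw [← QOp.actOn_one ∅]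
  ext x y
  simp only [QOp.actOn, Matrix.smul_apply, Matrix.of_apply]
  split_ifs <;> simp

/-! ### Generators of motions by local gates -/

section Gates

variable {n : ℕ}

/-- The product `U_m ⋯ U_1` of the gate list `[U_1, …, U_m]`. -/
def gateProd (l : List (QOp n)) : QOp n := l.reverse.prod

@[simp] theorem gateProd_nil : gateProd ([] : List (QOp n)) = 1 := rfl

@[simp] theorem gateProd_singleton (U : QOp n) : gateProd [U] = U := by simp [gateProd]

theorem gateProd_append (l₁ l₂ : List (QOp n)) :
    gateProd (l₁ ++ l₂) = gateProd l₂ * gateProd l₁ := by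
  simp [gateProd]

theorem gateProd_mem_unitary {l : List (QOp n)} (hl : ∀ U ∈ l, IsGate U) :
    gateProd l ∈ unitary (QOp n) :=
  Submonoid.list_prod_mem _ fun U hU => (hl U (List.mem_reverse.1 hU)).2

theorem norm_mul_sub_one_le {U V : QOp n} (hU : U ∈ unitary (QOp n)) :
    ‖U * V - 1‖ ≤ ‖U - 1‖ + ‖V - 1‖ := by
  have : U * V - 1 = U * (V - 1) + (U - 1) := by noncomm_ring
  rw [this, add_comm ‖U - 1‖]
  refine (norm_add_le _ _).trans ?_
  rw [CStarRing.norm_mem_unitary_mul _ hU]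

theorem prefix_append_cases {α : Type*} {l l₁ l₂ : List α} (h : l <+: l₁ ++ l₂) :
    l <+: l₁ ∨ ∃ l', l = l₁ ++ l' ∧ l' <+: l₂ := by
  rcases List.prefix_or_prefix_of_prefix h (List.prefix_append l₁ l₂) with h' | ⟨l', rfl⟩
  · exact Or.inl h'
  · exact Or.inr ⟨l', rfl, (List.prefix_append_right_inj l₁).1 h⟩

/-- Every partial product of the gate list `l` is within `r` of the identity. -/
def StaysWithin (l : List (QOp n)) (r : ℝ) : Prop :=
  ∀ l', l' <+: l → ‖gateProd l' - 1‖ ≤ r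

theorem staysWithin_singleton {U : QOp n} {r : ℝ} (h : ‖U - 1‖ ≤ r) : StaysWithin [U] r := by
  intro l hl
  rcases List.prefix_concat_iff (l₂ := []).1 hl with rfl | h'
  · simpa using h
  · rw [List.prefix_nil.1 h']
    simpa using (norm_nonneg _).trans h

theorem StaysWithin.append {l₁ l₂ : List (QOp n)} {r₁ r₂ r₃ : ℝ} (hl₂ : ∀ U ∈ l₂, IsGate U)
    (h₁ : StaysWithin l₁ r₁) (hp : ‖gateProd l₁ - 1‖ ≤ r₃) (h₂ : StaysWithin l₂ r₂) :
    StaysWithin (l₁ ++ l₂) (max r₁ (r₂ + r₃)) := by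
  intro l hl
  rcases prefix_append_cases hl with h | ⟨l', rfl, h⟩
  · exact (h₁ l h).trans (le_max_left _ _)
  · rw [gateProd_append]
    refine le_trans ?_ (le_max_right _ _)
    refine (norm_mul_sub_one_le
      (gateProd_mem_unitary fun U hU => hl₂ U (h.subset hU))).trans ?_
    exact add_le_add (h₂ l' h) hp

/-- `A` is the generator, to first order, of motions made of at most `N` gates: for all small `t`
some gate list multiplies to `1 + t A` up to the quadratic error `(C t) ^ 2`, and along the list the
partial products stay within `ρ + C |t|` of the identity. The drift `ρ` does not shrink with `t`. -/
def Generates (N : ℕ) (C ρ : ℝ) (A : QOp n) : Prop :=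
  ‖A‖ ≤ C ∧ ∀ t : ℝ, |t| * C ≤ 1 → ∃ l : List (QOp n), l.length ≤ N ∧ (∀ U ∈ l, IsGate U) ∧
    ‖gateProd l - 1‖ ≤ |t| * C ∧ ‖gateProd l - 1 - t • A‖ ≤ (|t| * C) ^ 2 ∧
    StaysWithin l (ρ + |t| * C)

theorem Generates.mono {N N' : ℕ} {C C' ρ ρ' : ℝ} {A : QOp n} (h : Generates N C ρ A)
    (hN : N ≤ N') (hC : C ≤ C') (hρ : ρ ≤ ρ') : Generates N' C' ρ' A := by
  have hC0 : 0 ≤ C := (norm_nonneg _).trans h.1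
  refine ⟨h.1.trans hC, fun t ht => ?_⟩
  have hle : |t| * C ≤ |t| * C' := by gcongr
  obtain ⟨l, h1, h2, h3, h4, h5⟩ := h.2 t (hle.trans ht)
  refine ⟨l, h1.trans hN, h2, h3.trans hle, h4.trans (by gcongr), fun l' hl' => ?_⟩
  exact (h5 l' hl').trans (add_le_add hρ hle)

theorem generates_zero {ρ : ℝ} (hρ : 0 ≤ ρ) : Generates 0 0 ρ (0 : QOp n) :=
  ⟨by simp, fun t _ => ⟨[], by simp, by simp, by simp, by simp, fun l' hl' => by
    rw [List.prefix_nil.1 hl']; simpa using hρ⟩⟩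

/-- Concatenating gate lists adds generators. The drift is not added, because the first list ends close
to the identity whatever its drift. -/
theorem Generates.add {N₁ N₂ : ℕ} {C₁ C₂ ρ : ℝ} {A B : QOp n} (hA : Generates N₁ C₁ ρ A)
    (hB : Generates N₂ C₂ ρ B) : Generates (N₁ + N₂) (C₁ + C₂) ρ (A + B) := by
  have hC1 : 0 ≤ C₁ := (norm_nonneg _).trans hA.1
  have hC2 : 0 ≤ C₂ := (norm_nonneg _).trans hB.1
  refine ⟨(norm_add_le _ _).trans (add_le_add hA.1 hB.1), fun t ht => ?_⟩
  have ht0 := abs_nonneg t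
  have e1 : 0 ≤ |t| * C₁ := by positivity
  have e2 : 0 ≤ |t| * C₂ := by positivity
  rw [mul_add] at ht
  obtain ⟨l₁, a1, a2, a3, a4, a5⟩ := hA.2 t (by linarith)
  obtain ⟨l₂, b1, b2, b3, b4, b5⟩ := hB.2 t (by linarith)
  refine ⟨l₁ ++ l₂, by simp; omega, ?_, ?_, ?_, ?_⟩
  · intro U hU
    rcases List.mem_append.1 hU with h | h
    exacts [a2 U h, b2 U h]
  · rw [gateProd_append]
    refine (norm_mul_sub_one_le (gateProd_mem_unitary b2)).trans ?_
    linarith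
  · rw [gateProd_append]
    set W₁ := gateProd l₁
    set W₂ := gateProd l₂
    have key : W₂ * W₁ - 1 - t • (A + B) =
        W₂ * (W₁ - 1 - t • A) + (W₂ - 1) * (t • A) + (W₂ - 1 - t • B) := by
      simp only [mul_sub, sub_mul, mul_one, one_mul, smul_add]
      abel
    rw [key]
    have n1 : ‖W₂ * (W₁ - 1 - t • A)‖ ≤ (|t| * C₁) ^ 2 := by
      rw [CStarRing.norm_mem_unitary_mul _ (gateProd_mem_unitary b2)]
      exact a4
    have n2 : ‖(W₂ - 1) * (t • A)‖ ≤ (|t| * C₂) * (|t| * C₁) := by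
      refine (norm_mul_le _ _).trans ?_
      rw [norm_smul, Real.norm_eq_abs]
      have := hA.1
      gcongr
    have := norm_add₃_le (a := W₂ * (W₁ - 1 - t • A)) (b := (W₂ - 1) * (t • A))
      (c := W₂ - 1 - t • B)
    nlinarith [mul_nonneg e1 e2]
  · have := StaysWithin.append b2 a5 a3 b5
    intro l hl
    refine (this l hl).trans (max_le ?_ ?_) <;> nlinarith

theorem Generates.smul {N : ℕ} {C ρ : ℝ} {A : QOp n} (h : Generates N C ρ A) (r : ℝ) :
    Generates N (|r| * C) ρ (r • A) := by
  refine ⟨?_, fun t ht => ?_⟩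
  · rw [norm_smul, Real.norm_eq_abs]
    have := h.1
    gcongr
  · obtain ⟨l, h1, h2, h3, h4, h5⟩ := h.2 (t * r) (by rwa [abs_mul, mul_assoc])
    rw [abs_mul, mul_assoc] at h3 h4 h5
    exact ⟨l, h1, h2, h3, by rwa [smul_smul], h5⟩

theorem Generates.sum {κ : Type*} {N : ℕ} {C ρ : ℝ} (hρ : 0 ≤ ρ) {A : κ → QOp n} (s : Finset κ)
    (h : ∀ k ∈ s, Generates N C ρ (A k)) :
    Generates (s.card * N) (s.card * C) ρ (∑ k ∈ s, A k) := by
  classical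
  induction s using Finset.induction_on with
  | empty => simpa using generates_zero hρ
  | insert a s ha ih =>
    rw [Finset.sum_insert ha, Finset.card_insert_of_notMem ha, add_comm (A a)]
    have := (ih fun k hk => h k (Finset.mem_insert_of_mem hk)).add
      (h a (Finset.mem_insert_self _ _))
    have e1 : s.card * N + N = (s.card + 1) * N := by ring
    have e2 : s.card * C + C = ((s.card + 1 : ℕ) : ℝ) * C := by push_cast; ring
    rwa [e1, e2] at this

/-- Conjugation by a gate `U` costs only the distance from `U` to the identity in drift. -/
theorem Generates.conj {N : ℕ} {C ρ a : ℝ} {A U : QOp n} (h : Generates N C ρ A) (hρ : 0 ≤ ρ)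
    (hU : IsGate U) (hU' : IsGate (star U)) (ha : ‖U - 1‖ ≤ a) :
    Generates (N + 2) C (ρ + a) (U * A * star U) := by
  have hC : 0 ≤ C := (norm_nonneg _).trans h.1
  have ha' : ‖star U - 1‖ ≤ a := by
    rw [← norm_star, star_sub, star_star, star_one]
    exact ha
  have ha0 : 0 ≤ a := (norm_nonneg _).trans ha
  have hUU : U * star U = 1 := hU.2.2
  have hnorm : ∀ X : QOp n, ‖U * X * star U‖ = ‖X‖ := fun X => by
    rw [CStarRing.norm_mul_mem_unitary _ hU'.2, CStarRing.norm_mem_unitary_mul _ hU.2]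
  refine ⟨(hnorm A).trans_le h.1, fun t ht => ?_⟩
  obtain ⟨l, h1, h2, h3, h4, h5⟩ := h.2 t ht
  have ht0 := abs_nonneg t
  have e1 : 0 ≤ |t| * C := by positivity
  have hl : ∀ V ∈ [star U] ++ l, IsGate V := by
    intro V hV
    rcases List.mem_append.1 hV with h | h
    · rw [List.mem_singleton.1 h]; exact hU'
    · exact h2 V h
  have hW : gateProd (([star U] ++ l) ++ [U]) - 1 = U * (gateProd l - 1) * star U := by
    simp only [gateProd_append, gateProd_singleton]
    rw [mul_sub, sub_mul, mul_one, hUU, mul_assoc]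
  refine ⟨([star U] ++ l) ++ [U], by simp; omega, ?_, ?_, ?_, ?_⟩
  · intro V hV
    rcases List.mem_append.1 hV with h | h
    · exact hl V h
    · rw [List.mem_singleton.1 h]; exact hU
  · rw [hW, hnorm]
    exact h3
  · rw [hW]
    have : U * (gateProd l - 1) * star U - t • (U * A * star U) =
        U * (gateProd l - 1 - t • A) * star U := by
      rw [mul_sub U _ (t • A), sub_mul _ _ (star U), mul_smul_comm, smul_mul_assoc]
    rw [this, hnorm]
    exact h4
  · have s2 := (staysWithin_singleton ha').append h2 (by simpa using ha') h5
    have s3 : ‖gateProd ([star U] ++ l) - 1‖ ≤ |t| * C + a := by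
      rw [gateProd_append, gateProd_singleton]
      exact (norm_mul_sub_one_le (gateProd_mem_unitary h2)).trans (add_le_add h3 ha')
    intro l' hl'
    rcases List.prefix_concat_iff.1 hl' with rfl | h
    · rw [hW, hnorm]
      linarith
    · refine (s2 l' h).trans (max_le ?_ ?_) <;> linarith

theorem norm_I_smul_pauliString_le (f : Fin n → Fin 4) : ‖Complex.I • pauliString f‖ ≤ 1 := by
  have h : Complex.I • pauliString f ∈ unitary (QOp n) := by
    have := I_smul_pauliString_mul_self f
    rw [Unitary.mem_iff, star_smul, Matrix.star_eq_conjTranspose, pauliString_conjTranspose]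
    simp only [Complex.star_def, Complex.conj_I, neg_smul, neg_mul, mul_neg, this, neg_neg,
      and_self]
  exact (CStarRing.norm_of_mem_unitary h).le

theorem norm_smul_one_add_smul_pauliString_le (f : Fin n → Fin 4) (x y : ℝ) :
    ‖x • (1 : QOp n) + y • (Complex.I • pauliString f)‖ ≤ |x| + |y| := by
  refine (norm_add_le _ _).trans ?_
  rw [norm_smul, norm_smul, CStarRing.norm_one, mul_one, Real.norm_eq_abs, Real.norm_eq_abs]
  gcongr
  exact mul_le_of_le_one_right (abs_nonneg _) (norm_I_smul_pauliString_le f)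

theorem abs_cos_sub_one_le (t : ℝ) : |Real.cos t - 1| ≤ t ^ 2 / 2 := by
  rw [abs_le]
  constructor <;> linarith [Real.one_sub_sq_div_two_le_cos (x := t), Real.cos_le_one t, sq_nonneg t]

theorem norm_pauliRot_sub_one_le (f : Fin n → Fin 4) {t : ℝ} (ht : |t| ≤ 1) :
    ‖pauliRot f t - 1‖ ≤ 2 * |t| := by
  have h : pauliRot f t - 1 =
      (Real.cos t - 1) • (1 : QOp n) + Real.sin t • (Complex.I • pauliString f) := by
    rw [pauliRot, sub_smul, one_smul]
    abel
  rw [h]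
  refine (norm_smul_one_add_smul_pauliString_le f _ _).trans ?_
  have h1 := abs_cos_sub_one_le t
  have h2 := Real.abs_sin_le_abs (x := t)
  rw [← sq_abs] at h1
  nlinarith [abs_nonneg t]

theorem norm_pauliRot_sub_one_sub_le (f : Fin n → Fin 4) {t : ℝ} (ht : |t| ≤ 1) :
    ‖pauliRot f t - 1 - t • (Complex.I • pauliString f)‖ ≤ (2 * |t|) ^ 2 := by
  have h : pauliRot f t - 1 - t • (Complex.I • pauliString f) =
      (Real.cos t - 1) • (1 : QOp n) + (Real.sin t - t) • (Complex.I • pauliString f) := by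
    rw [pauliRot, sub_smul, sub_smul, one_smul]
    abel
  rw [h]
  refine (norm_smul_one_add_smul_pauliString_le f _ _).trans ?_
  have h1 := abs_cos_sub_one_le t
  have h2 := Real.sin_bound ht
  have h3 : |Real.sin t - t| ≤ |t| ^ 3 / 6 + |t| ^ 5 / 100 := by
    have : Real.sin t - t = (Real.sin t - (t - t ^ 3 / 6)) + -(t ^ 3 / 6) := by ring
    rw [this]
    refine (abs_add_le _ _).trans ?_
    rw [abs_neg, abs_div, abs_pow, abs_of_pos (by norm_num : (0 : ℝ) < 6)]
    linarith
  rw [← sq_abs] at h1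
  have h4 : |t| ^ 3 ≤ |t| ^ 2 := pow_le_pow_of_le_one (abs_nonneg t) ht (by norm_num)
  have h5 : |t| ^ 5 ≤ |t| ^ 2 := pow_le_pow_of_le_one (abs_nonneg t) ht (by norm_num)
  nlinarith [sq_nonneg |t|]

theorem generates_pauliString_of_card_le_two (f : Fin n → Fin 4) (S : Finset (Fin n))
    (hS : S.card ≤ 2) (hf : ∀ i, i ∉ S → f i = 0) :
    Generates 1 2 0 (Complex.I • pauliString f) := by
  refine ⟨(norm_I_smul_pauliString_le f).trans one_le_two, fun t ht => ?_⟩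
  have ht1 : |t| ≤ 1 := by linarith [abs_nonneg t]
  have h := norm_pauliRot_sub_one_le f ht1
  rw [mul_comm] at h
  refine ⟨[pauliRot f t], by simp, ?_, by simpa using h, ?_, ?_⟩
  · intro U hU
    rw [List.mem_singleton.1 hU]
    exact isGate_pauliRot f S hS hf t
  · rw [gateProd_singleton, mul_comm]
    exact norm_pauliRot_sub_one_sub_le f ht1
  · exact staysWithin_singleton (by simpa using h)

/-- Commutators with a `2`-local Pauli string `J = i T`, up to the factor `sin (2 a)`, are differences
of two conjugates by the rotations `cos a ± sin a • J`, which are close to the identity. -/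
theorem Generates.commutator {N : ℕ} {C ρ a : ℝ} {X : QOp n} (h : Generates N C ρ X) (hρ : 0 ≤ ρ)
    (p : Fin n → Fin 4) (S : Finset (Fin n)) (hS : S.card ≤ 2) (hp : ∀ i, i ∉ S → p i = 0)
    (ha : 0 < a) (ha' : a ≤ 1 / 2) :
    Generates (2 * (N + 2)) (2 * C / a) (ρ + 2 * a)
      ((Complex.I • pauliString p) * X - X * (Complex.I • pauliString p)) := by
  have hC : 0 ≤ C := (norm_nonneg _).trans h.1
  have hg := isGate_pauliRot p S hS hp
  have habs : |a| ≤ 1 := by rw [abs_of_pos ha]; linarith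
  have hst := star_pauliRot p
  have hd : ‖pauliRot p a - 1‖ ≤ 2 * a := by
    simpa [abs_of_pos ha] using norm_pauliRot_sub_one_le p habs
  have hd' : ‖pauliRot p (-a) - 1‖ ≤ 2 * a := by
    simpa [abs_of_pos ha] using norm_pauliRot_sub_one_le p (t := -a) (by rwa [abs_neg])
  have g1 := h.conj hρ (hg a) (by rw [hst]; exact hg _) hd
  have g2 := h.conj hρ (hg (-a)) (by rw [hst]; exact hg _) hd'
  rw [hst] at g1 g2
  -- Jordan's inequality bounds the cost factor `1 / sin (2 a)` by `1 / a`.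
  have hsin : a ≤ Real.sin (2 * a) := by
    have h1 := Real.mul_le_sin (x := 2 * a) (by linarith) (by linarith [Real.pi_gt_three])
    refine le_trans ?_ h1
    have : 1 ≤ 2 / Real.pi * 2 := by
      rw [div_mul_eq_mul_div, le_div_iff₀ Real.pi_pos]
      linarith [Real.pi_le_four]
    nlinarith
  have hsin0 : 0 < Real.sin (2 * a) := ha.trans_le hsin
  have g3 := (g1.add (g2.smul (-1))).smul (Real.sin (2 * a))⁻¹
  have key : (Real.sin (2 * a))⁻¹ • (pauliRot p a * X * pauliRot p (-a) +
      (-1 : ℝ) • (pauliRot p (-a) * X * pauliRot p (- -a))) =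
      (Complex.I • pauliString p) * X - X * (Complex.I • pauliString p) := by
    rw [inv_smul_eq_iff₀ hsin0.ne', Real.sin_two_mul, neg_neg]
    simp only [pauliRot, Real.cos_neg, Real.sin_neg]
    generalize Complex.I • pauliString p = J
    simp only [add_mul, mul_add, smul_mul_assoc, mul_smul_comm, one_mul, mul_one, neg_smul,
      neg_mul, mul_neg]
    module
  rw [key] at g3
  refine g3.mono (by omega) ?_ le_rfl
  rw [abs_of_pos (inv_pos.2 hsin0), abs_neg, abs_one, one_mul, inv_mul_eq_div]
  have : C + C = 2 * C := by ring
  rw [this]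
  gcongr

/-- A Pauli string of weight above two is a commutator of a `2`-local string with a string of smaller
weight, so induction on the weight generates all of them. -/
theorem generates_pauliString {a : ℝ} (ha : 0 < a) (ha' : a ≤ 1 / 2) (k : ℕ) :
    ∀ (f : Fin n → Fin 4) (S : Finset (Fin n)), S.card ≤ k → (∀ i, i ∉ S → f i = 0) →
      Generates (8 ^ k) (2 * a⁻¹ ^ k) (k * (2 * a)) (Complex.I • pauliString f) := by
  have hinv : 1 ≤ a⁻¹ := (one_le_inv₀ ha).2 (by linarith)
  induction k with
  | zero =>
    intro f S hS hf
    exact (generates_pauliString_of_card_le_two f S (by omega) hf).mono (by simp) (by simp)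
      (by simp)
  | succ k ih =>
    intro f S hS hf
    by_cases hS2 : S.card ≤ 2
    · refine (generates_pauliString_of_card_le_two f S hS2 hf).mono
        (Nat.one_le_pow _ _ (by norm_num)) ?_ (by positivity)
      linarith [one_le_pow₀ hinv (n := k + 1)]
    obtain ⟨i, hi, j, hj, hij⟩ := Finset.one_lt_card.1 (by omega : 1 < S.card)
    have h8 : 1 ≤ 8 ^ k := Nat.one_le_pow _ _ (by norm_num)
    have hρ : (k : ℝ) * (2 * a) + 2 * a = ((k + 1 : ℕ) : ℝ) * (2 * a) := by push_cast; ring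
    by_cases hfj : f j = 0
    · refine (ih f (S.erase j) (by rw [Finset.card_erase_of_mem hj]; omega) ?_).mono
        (by rw [pow_succ]; omega) ?_ (by linarith)
      · intro x hx
        by_cases hxj : x = j
        · rw [hxj, hfj]
        · exact hf x fun h => hx (Finset.mem_erase.2 ⟨hxj, h⟩)
      · have := pow_le_pow_right₀ hinv (k.le_add_right 1)
        linarith
    obtain ⟨u, v, huv, hvu⟩ := exists_pauli_mul hfj
    -- `f` is a commutator of the `2`-local `p`, on the qubits `i` and `j`, with `g`, which is trivial
    -- on `i`: the factors at `j` anticommute and multiply to `σ_{f j}`, all others commute.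
    let g : Fin n → Fin 4 := fun x => if x = i then 0 else if x = j then v else f x
    let p : Fin n → Fin 4 := fun x => if x = i then f i else if x = j then u else 0
    have hg := ih g (S.erase i) (by rw [Finset.card_erase_of_mem hi]; omega) (by
      intro x hx
      by_cases hxi : x = i
      · simp [g, hxi]
      · have hxS : x ∉ S := fun h => hx (Finset.mem_erase.2 ⟨hxi, h⟩)
        have hxj : x ≠ j := fun h => hxS (h ▸ hj)
        simp [g, hxi, hxj, hf x hxS])
    have hc := (hg.commutator (by positivity) p {i, j} Finset.card_le_two (by
      intro x hx
      simp only [Finset.mem_insert, Finset.mem_singleton, not_or] at hx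
      simp [p, hx.1, hx.2]) ha ha').smul (-1 / 2)
    have e1 : pauliString p * pauliString g = Complex.I • pauliString f := by
      simp only [pauliString, tensorOp_mul]
      refine tensorOp_smul_factor _ _ j _ ?_ fun x hx => ?_
      · simpa [p, g, hij.symm] using huv
      · by_cases hxi : x = i <;> simp [p, g, hxi, hx, pauli]
    have e2 : pauliString g * pauliString p = (-Complex.I) • pauliString f := by
      simp only [pauliString, tensorOp_mul]
      refine tensorOp_smul_factor _ _ j _ ?_ fun x hx => ?_
      · simpa [p, g, hij.symm] using hvu
      · by_cases hxi : x = i <;> simp [p, g, hxi, hx, pauli]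
    have e3 : (-1 / 2 : ℝ) • ((Complex.I • pauliString p) * (Complex.I • pauliString g) -
        (Complex.I • pauliString g) * (Complex.I • pauliString p)) =
        Complex.I • pauliString f := by
      rw [smul_mul_smul_comm, smul_mul_smul_comm, e1, e2, Complex.I_mul_I]
      module
    rw [e3] at hc
    refine hc.mono (by rw [pow_succ]; omega) (le_of_eq ?_) hρ.le
    rw [pow_succ, abs_div, abs_neg, abs_one, abs_two]
    field_simp

/-- Every skew-Hermitian operator is generated, by its Pauli expansion. -/
theorem generates_skewHermitian {a : ℝ} (ha : 0 < a) (ha' : a ≤ 1 / 2) {A : QOp n} (hA : Aᴴ = -A)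
    {B : ℝ} (hB : ∀ x y, ‖A x y‖ ≤ B) :
    Generates (4 ^ n * 8 ^ n) (4 ^ n * (2 ^ n * B * (2 * a⁻¹ ^ n))) (n * (2 * a)) A := by
  obtain ⟨r, hr, hA'⟩ := exists_pauliString_expansion A hA hB
  have h := Generates.sum (N := 8 ^ n) (C := 2 ^ n * B * (2 * a⁻¹ ^ n)) (ρ := n * (2 * a))
    (by positivity) (A := fun f => r f • (Complex.I • pauliString f)) Finset.univ (fun f _ => by
      refine ((generates_pauliString ha ha' n f Finset.univ (by simp) (by simp)).smul (r f)).mono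
        le_rfl ?_ le_rfl
      have := hr f
      rw [Fintype.card_fin] at this
      gcongr)
  rw [← hA'] at h
  simpa using h

end Gates

/-! ### Energy and the low-energy path -/

section States

variable {n : ℕ}

theorem toEuclideanLin_mul_apply (A B : QOp n) (v : QState n) :
    toEuclideanLin (A * B) v = toEuclideanLin A (toEuclideanLin B v) := by
  simp [toLpLin_apply, Matrix.mulVec_mulVec]

theorem toEuclideanLin_one_apply (v : QState n) : toEuclideanLin (1 : QOp n) v = v := by
  simp

theorem norm_toEuclideanLin_le (A : QOp n) (v : QState n) :
    ‖toEuclideanLin A v‖ ≤ ‖A‖ * ‖v‖ := l2_opNorm_mulVec A v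

theorem norm_toEuclideanLin_of_mem_unitary {U : QOp n} (hU : U ∈ unitary (QOp n)) (v : QState n) :
    ‖toEuclideanLin U v‖ = ‖v‖ := by
  have h1 : ∀ W ∈ unitary (QOp n), ∀ w : QState n, ‖toEuclideanLin W w‖ ≤ ‖w‖ := by
    intro W hW w
    have := norm_toEuclideanLin_le W w
    rwa [CStarRing.norm_of_mem_unitary hW, one_mul] at this
  refine le_antisymm (h1 U hU v) ?_
  have := h1 (star U) (Unitary.star_mem hU) (toEuclideanLin U v)
  rwa [← toEuclideanLin_mul_apply, hU.1, toEuclideanLin_one_apply] at this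

theorem applyGates_eq (l : List (QOp n)) (v : QState n) :
    QState.applyGates l v = toEuclideanLin (gateProd l) v := by
  induction l generalizing v with
  | nil => simp [QState.applyGates]
  | cons U l ih =>
    have h : gateProd (U :: l) = gateProd l * U := by simp [gateProd]
    rw [h, toEuclideanLin_mul_apply, ← ih]
    rfl

theorem applyGates_append (l₁ l₂ : List (QOp n)) (v : QState n) :
    QState.applyGates (l₁ ++ l₂) v = QState.applyGates l₂ (QState.applyGates l₁ v) := by
  simp [QState.applyGates]

theorem norm_applyGates {l : List (QOp n)} (hl : ∀ U ∈ l, IsGate U) (v : QState n) :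
    ‖QState.applyGates l v‖ = ‖v‖ := by
  rw [applyGates_eq, norm_toEuclideanLin_of_mem_unitary (gateProd_mem_unitary hl)]

theorem norm_applyGates_sub_applyGates {l : List (QOp n)} (hl : ∀ U ∈ l, IsGate U)
    (v w : QState n) :
    ‖QState.applyGates l v - QState.applyGates l w‖ = ‖v - w‖ := by
  rw [applyGates_eq, applyGates_eq, ← map_sub,
    norm_toEuclideanLin_of_mem_unitary (gateProd_mem_unitary hl)]

theorem norm_applyGates_sub_le {l : List (QOp n)} {v : QState n} (hv : ‖v‖ = 1) {r : ℝ}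
    (h : ‖gateProd l - 1‖ ≤ r) : ‖QState.applyGates l v - v‖ ≤ r := by
  have h1 := norm_toEuclideanLin_le (gateProd l - 1) v
  rw [map_sub, LinearMap.sub_apply, toEuclideanLin_one_apply, hv, mul_one] at h1
  rw [applyGates_eq]
  exact h1.trans h

open scoped MatrixOrder in
theorem norm_le_one_of_posSemidef {H : QOp n} (h0 : H.PosSemidef) (h1 : (1 - H).PosSemidef) :
    ‖H‖ ≤ 1 := by
  rw [CStarAlgebra.norm_le_one_iff_of_nonneg H (Matrix.nonneg_iff_posSemidef.2 h0)]
  exact Matrix.le_iff.2 h1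

theorem energy_le_add_two_mul_norm_sub {H : QOp n} (hH : ‖H‖ ≤ 1) {v w : QState n} (hv : ‖v‖ = 1)
    (hw : ‖w‖ = 1) : QState.energy H v ≤ QState.energy H w + 2 * ‖v - w‖ := by
  have key : QState.energy H v - QState.energy H w =
      (inner ℂ (v - w) (toEuclideanLin H v) + inner ℂ w (toEuclideanLin H (v - w))).re := by
    simp only [QState.energy, map_sub, inner_sub_left, inner_sub_right, Complex.add_re,
      Complex.sub_re]
    ring
  have hop : ∀ x : QState n, ‖toEuclideanLin H x‖ ≤ ‖x‖ := fun x =>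
    (norm_toEuclideanLin_le H x).trans (mul_le_of_le_one_left (norm_nonneg _) hH)
  have h1 : ‖(inner ℂ (v - w) (toEuclideanLin H v) : ℂ)‖ ≤ ‖v - w‖ * 1 :=
    (norm_inner_le_norm _ _).trans (by gcongr; exact (hop v).trans hv.le)
  have h2 : ‖(inner ℂ w (toEuclideanLin H (v - w)) : ℂ)‖ ≤ 1 * ‖v - w‖ :=
    (norm_inner_le_norm _ _).trans (by rw [hw]; gcongr; exact hop _)
  have h3 := Complex.re_le_norm
    (inner ℂ (v - w) (toEuclideanLin H v) + inner ℂ w (toEuclideanLin H (v - w)))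
  have h4 := norm_add_le (inner ℂ (v - w) (toEuclideanLin H v) : ℂ)
    (inner ℂ w (toEuclideanLin H (v - w)))
  linarith

theorem energy_smul (H : QOp n) (c : ℂ) (v : QState n) :
    QState.energy H (c • v) = ‖c‖ ^ 2 * QState.energy H v := by
  rw [QState.energy, map_smul, inner_smul_left, inner_smul_right, ← mul_assoc,
    ← Complex.normSq_eq_conj_mul_self, Complex.re_ofReal_mul, Complex.normSq_eq_norm_sq]
  rfl

theorem energy_add {H : QOp n} (hH : H.IsHermitian) (v w : QState n) :
    QState.energy H (v + w) = QState.energy H v + QState.energy H w +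
      2 * (inner ℂ v (toEuclideanLin H w)).re := by
  have h : (inner ℂ w (toEuclideanLin H v)).re = (inner ℂ v (toEuclideanLin H w)).re := by
    have h1 := (Matrix.isSymmetric_toEuclideanLin_iff.2 hH) w v
    rw [← h1, ← inner_conj_symm, Complex.conj_re]
  simp only [QState.energy, map_add, inner_add_left, inner_add_right, Complex.add_re, h]
  ring

/-- Some unit complex number turns `z` purely imaginary; the choice between it and its negative
controls the sign of a second real part. -/
theorem exists_phase (z w : ℂ) : ∃ e : ℂ, ‖e‖ = 1 ∧ (e * z).re = 0 ∧ 0 ≤ (e * w).re := by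
  obtain ⟨e, he, hz⟩ : ∃ e : ℂ, ‖e‖ = 1 ∧ (e * z).re = 0 := by
    by_cases hz : z = 0
    · exact ⟨1, by simp, by simp [hz]⟩
    · refine ⟨Complex.I * (star z / ‖z‖), ?_, ?_⟩
      · have : ‖z‖ ≠ 0 := by simpa using hz
        simp [this]
      · have : Complex.I * (star z / ‖z‖) * z = Complex.I * ((Complex.normSq z / ‖z‖ : ℝ) : ℂ) := by
          push_cast
          rw [Complex.normSq_eq_conj_mul_self, Complex.star_def]
          ring
        rw [this]
        simp
  rcases le_total 0 (e * w).re with h | h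
  · exact ⟨e, he, hz, h⟩
  · exact ⟨-e, by rwa [norm_neg], by rw [neg_mul, Complex.neg_re, hz, neg_zero],
      by rw [neg_mul, Complex.neg_re]; linarith⟩

theorem norm_normalize_sub_le {E : Type*} [NormedAddCommGroup E] [NormedSpace ℝ E] {x y : E}
    (hx : x ≠ 0) (hy : y ≠ 0) : ‖‖x‖⁻¹ • x - ‖y‖⁻¹ • y‖ ≤ 2 * ‖x - y‖ / ‖x‖ := by
  have hx' : 0 < ‖x‖ := norm_pos_iff.2 hx
  have hy' : 0 < ‖y‖ := norm_pos_iff.2 hy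
  have e : ‖x‖⁻¹ • x - ‖y‖⁻¹ • y = ‖x‖⁻¹ • (x - y) + (‖x‖⁻¹ - ‖y‖⁻¹) • y := by module
  rw [e]
  refine (norm_add_le _ _).trans ?_
  have h1 : |‖x‖⁻¹ - ‖y‖⁻¹| * ‖y‖ ≤ ‖x - y‖ / ‖x‖ := by
    have h2 : ‖x‖⁻¹ - ‖y‖⁻¹ = (‖y‖ - ‖x‖) / (‖x‖ * ‖y‖) := by field_simp
    rw [h2, abs_div, abs_of_pos (mul_pos hx' hy')]
    have h3 := abs_norm_sub_norm_le x y
    rw [abs_sub_comm]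
    calc _ = |‖x‖ - ‖y‖| / ‖x‖ := by field_simp
      _ ≤ _ := by gcongr
  rw [norm_smul, norm_smul, norm_inv, norm_norm, Real.norm_eq_abs]
  calc _ ≤ ‖x‖⁻¹ * ‖x - y‖ + ‖x - y‖ / ‖x‖ := by gcongr
    _ = _ := by ring

/-- Up to a global phase of `ψ`, two states of energy at most `η` are joined by a Lipschitz path of
unit vectors of energy at most `η`: the normalized segment. The phase kills the cross term of the
quadratic form of `H - η`, and its remaining sign keeps the segment away from zero. -/
theorem exists_lowEnergy_path {H : QOp n} (hH : H.IsHermitian) {η : ℝ} {ψ φ : QState n}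
    (hψ : ‖ψ‖ = 1) (hφ : ‖φ‖ = 1) (hEψ : QState.energy H ψ ≤ η) (hEφ : QState.energy H φ ≤ η) :
    ∃ (c : ℂ) (γ : ℝ → QState n), ‖c‖ = 1 ∧ γ 0 = c • ψ ∧ γ 1 = φ ∧
      ∀ s ∈ Set.Icc (0 : ℝ) 1, ‖γ s‖ = 1 ∧ QState.energy H (γ s) ≤ η ∧
        ∀ t ∈ Set.Icc (0 : ℝ) 1, ‖γ s - γ t‖ ≤ 8 * |s - t| := by
  obtain ⟨e, he, hz, hw⟩ := exists_phase
    (inner ℂ ψ (toEuclideanLin H φ) - η * inner ℂ ψ φ) (inner ℂ ψ φ)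
  obtain ⟨χ, hχ⟩ : ∃ χ : QState n, χ = star e • ψ := ⟨_, rfl⟩
  have hχ1 : ‖χ‖ = 1 := by rw [hχ, norm_smul, norm_star, he, hψ, one_mul]
  have hEχ : QState.energy H χ ≤ η := by
    rw [hχ, energy_smul, norm_star, he, one_pow, one_mul]
    exact hEψ
  have i1 : 0 ≤ (inner ℂ χ φ).re := by
    rw [hχ, inner_smul_left, Complex.star_def, Complex.conj_conj]
    exact hw
  have i2 : (inner ℂ χ (toEuclideanLin H φ)).re = η * (inner ℂ χ φ).re := by
    have : inner ℂ χ (toEuclideanLin H φ) - η * inner ℂ χ φ =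
        e * (inner ℂ ψ (toEuclideanLin H φ) - η * inner ℂ ψ φ) := by
      rw [hχ, inner_smul_left, inner_smul_left, Complex.star_def, Complex.conj_conj]
      ring
    rw [← this, Complex.sub_re, Complex.re_ofReal_mul] at hz
    linarith
  let g : ℝ → QState n := fun s => ((1 - s : ℝ) : ℂ) • χ + (s : ℂ) • φ
  have hg2 : ∀ s, ‖g s‖ ^ 2 = (1 - s) ^ 2 + s ^ 2 + 2 * ((1 - s) * (s * (inner ℂ χ φ).re)) := by
    intro s
    have := norm_add_sq (𝕜 := ℂ) (((1 - s : ℝ) : ℂ) • χ) ((s : ℂ) • φ)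
    simp only [g]
    rw [this, norm_smul, norm_smul, hχ1, hφ, inner_smul_left, inner_smul_right, Complex.conj_ofReal]
    simp only [RCLike.re_to_complex, Complex.re_ofReal_mul, Complex.norm_real, Real.norm_eq_abs,
      mul_one, sq_abs]
    ring
  have hgE : ∀ s ∈ Set.Icc (0 : ℝ) 1, QState.energy H (g s) ≤ η * ‖g s‖ ^ 2 := by
    intro s hs
    rw [hg2]
    simp only [g]
    rw [energy_add hH, energy_smul, energy_smul, map_smul, inner_smul_left, inner_smul_right,
      Complex.conj_ofReal, Complex.re_ofReal_mul, Complex.re_ofReal_mul, i2]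
    simp only [Complex.norm_real, Real.norm_eq_abs, sq_abs]
    nlinarith [mul_le_mul_of_nonneg_left hEχ (sq_nonneg (1 - s)),
      mul_le_mul_of_nonneg_left hEφ (sq_nonneg s)]
  have hgn : ∀ s ∈ Set.Icc (0 : ℝ) 1, 1 / 2 ≤ ‖g s‖ := by
    intro s hs
    have h1 := hg2 s
    have h2 : 0 ≤ (1 - s) * (s * (inner ℂ χ φ).re) :=
      mul_nonneg (by linarith [hs.2]) (mul_nonneg hs.1 i1)
    nlinarith [norm_nonneg (g s), sq_nonneg (2 * s - 1)]
  have hg0 : ∀ s ∈ Set.Icc (0 : ℝ) 1, g s ≠ 0 := fun s hs h => by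
    have := hgn s hs
    rw [h, norm_zero] at this
    linarith
  refine ⟨star e, fun s => ‖g s‖⁻¹ • g s, by rwa [norm_star], ?_, ?_, fun s hs => ⟨?_, ?_, ?_⟩⟩
  · rw [← hχ]
    simp [g, hχ1]
  · simp [g, hφ]
  · rw [norm_smul, norm_inv, norm_norm, inv_mul_cancel₀ (norm_ne_zero_iff.2 (hg0 s hs))]
  · have h1 := hgE s hs
    have h2 : 0 < ‖g s‖ := norm_pos_iff.2 (hg0 s hs)
    have h3 : ‖g s‖⁻¹ • g s = ((‖g s‖⁻¹ : ℝ) : ℂ) • g s := (Complex.coe_smul _ _).symm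
    simp only [h3]
    rw [energy_smul, Complex.norm_real, norm_inv, norm_norm, inv_pow, inv_mul_le_iff₀ (by positivity)]
    linarith
  · intro t ht
    have hst : ‖g s - g t‖ ≤ 2 * |s - t| := by
      have : g s - g t = (s - t) • (φ - χ) := by
        simp only [g, Complex.coe_smul]
        module
      rw [this, norm_smul, Real.norm_eq_abs, mul_comm]
      gcongr
      refine (norm_sub_le _ _).trans ?_
      rw [hχ1, hφ]
      norm_num
    refine (norm_normalize_sub_le (hg0 s hs) (hg0 t ht)).trans ?_
    have h1 := hgn s hs
    rw [div_le_iff₀ (by linarith)]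
    nlinarith [abs_nonneg (s - t)]

/-- The skew-Hermitian operator `d γ* - γ d* + i Im⟨d, γ⟩` moves the unit vector `γ` by
`d = γ' - γ`, up to second order. -/
theorem exists_skewHermitian_step {γ γ' : QState n} (hγ : ‖γ‖ = 1) (hγ' : ‖γ'‖ = 1) :
    ∃ A : QOp n, Aᴴ = -A ∧ (∀ x y, ‖A x y‖ ≤ 3 * ‖γ' - γ‖) ∧
      ‖toEuclideanLin A γ - (γ' - γ)‖ ≤ ‖γ' - γ‖ ^ 2 := by
  set d : QState n := γ' - γ with hd
  set z : ℂ := inner ℂ d γ with hzdef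
  have hzn : ‖z‖ ≤ ‖d‖ := by
    have := norm_inner_le_norm (𝕜 := ℂ) d γ
    rwa [hγ, mul_one] at this
  -- For unit vectors `γ` and `γ + d`, the real part of `⟨d, γ⟩` is of second order in `d`.
  have hzre : |z.re| ≤ ‖d‖ ^ 2 := by
    have h1 : γ' = d + γ := by rw [hd]; abel
    have h2 := norm_add_sq (𝕜 := ℂ) d γ
    rw [← h1, hγ, hγ'] at h2
    have h3 : z.re = -(‖d‖ ^ 2 / 2) := by
      simp only [RCLike.re_to_complex] at h2
      rw [hzdef]
      linarith
    rw [h3, abs_neg, abs_of_nonneg (by positivity)]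
    linarith [sq_nonneg ‖d‖]
  have hself : inner ℂ γ γ = (1 : ℂ) := by
    rw [inner_self_eq_norm_sq_to_K, hγ]; simp
  refine ⟨vecMulVec d.ofLp (star γ.ofLp) - vecMulVec γ.ofLp (star d.ofLp) +
    ((z.im : ℂ) * Complex.I) • 1, ?_, ?_, ?_⟩
  · simp only [conjTranspose_add, conjTranspose_sub, conjTranspose_vecMulVec, star_star,
      conjTranspose_smul, conjTranspose_one, star_mul', Complex.star_def, Complex.conj_ofReal,
      Complex.conj_I]
    module
  · intro x y
    have hx : ∀ (v : QState n) (i), ‖v i‖ ≤ ‖v‖ := fun v i => PiLp.norm_apply_le v i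
    have t1 : ‖d x * star (γ y)‖ ≤ ‖d‖ * 1 := by
      rw [norm_mul, norm_star]
      exact mul_le_mul (hx _ _) ((hx _ _).trans hγ.le) (norm_nonneg _) (norm_nonneg _)
    have t2 : ‖γ x * star (d y)‖ ≤ 1 * ‖d‖ := by
      rw [norm_mul, norm_star]
      exact mul_le_mul ((hx _ _).trans hγ.le) (hx _ _) (norm_nonneg _) zero_le_one
    have t3 : ‖((z.im : ℂ) * Complex.I) * (1 : QOp n) x y‖ ≤ ‖d‖ := by
      rw [Matrix.one_apply, norm_mul, norm_mul, Complex.norm_I, mul_one, Complex.norm_real,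
        Real.norm_eq_abs]
      have := (Complex.abs_im_le_norm z).trans hzn
      split_ifs <;> simp [this]
    have := norm_add_le (d x * star (γ y) - γ x * star (d y))
      (((z.im : ℂ) * Complex.I) * (1 : QOp n) x y)
    have := norm_sub_le (d x * star (γ y)) (γ x * star (d y))
    simp only [Matrix.add_apply, Matrix.sub_apply, vecMulVec_apply, Matrix.smul_apply, smul_eq_mul,
      Pi.star_apply]
    linarith
  · have key : toEuclideanLin (vecMulVec d.ofLp (star γ.ofLp) - vecMulVec γ.ofLp (star d.ofLp) +
        ((z.im : ℂ) * Complex.I) • (1 : QOp n)) γ - d = (-(z.re : ℂ)) • γ := by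
      have h1 : ∀ u w : QState n, toEuclideanLin (vecMulVec u.ofLp (star w.ofLp)) γ =
          (inner ℂ w γ : ℂ) • u := by
        intro u w
        ext i
        simp [toLpLin_apply, vecMulVec_mulVec, EuclideanSpace.inner_eq_star_dotProduct,
          dotProduct_comm, mul_comm]
      rw [map_add, map_sub, map_smul, LinearMap.add_apply, LinearMap.sub_apply,
        LinearMap.smul_apply, toEuclideanLin_one_apply, h1, h1, hself, ← hzdef]
      nth_rw 1 [← Complex.re_add_im z]
      module
    rw [key, norm_smul, hγ, norm_neg, Complex.norm_real, Real.norm_eq_abs, mul_one]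
    exact hzre

end States

/-! ### Following the path by gates -/

section Traversal

variable {n : ℕ}

/-- One small step along a path of unit vectors, by gates that stay near the identity. Here `Q` is the
cost of generating a skew-Hermitian operator relative to the size of its entries. -/
theorem exists_gates_step {N : ℕ} {Q ρ d : ℝ} (hQ : 1 ≤ Q)
    (hgen : ∀ (A : QOp n) (B : ℝ), Aᴴ = -A → (∀ x y, ‖A x y‖ ≤ 3 * B) → Generates N (B * Q) ρ A)
    (hd : d * Q ≤ 1) {γ γ' : QState n} (hγ : ‖γ‖ = 1) (hγ' : ‖γ'‖ = 1) (hγγ' : ‖γ' - γ‖ ≤ d) :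
    ∃ l : List (QOp n), l.length ≤ N ∧ (∀ U ∈ l, IsGate U) ∧
      ‖QState.applyGates l γ - γ'‖ ≤ 2 * (d * Q) ^ 2 ∧ StaysWithin l (ρ + d * Q) := by
  obtain ⟨A, hA, hAB, hstep⟩ := exists_skewHermitian_step hγ hγ'
  have hd0 : 0 ≤ d := (norm_nonneg _).trans hγγ'
  obtain ⟨l, h1, h2, -, h4, h5⟩ := (hgen A d hA fun x y => (hAB x y).trans (by gcongr)).2 1
    (by simpa using hd)
  simp only [abs_one, one_mul, one_smul] at h4 h5
  refine ⟨l, h1, h2, ?_, h5⟩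
  have key : QState.applyGates l γ - γ' =
      toEuclideanLin (gateProd l - 1 - A) γ + (toEuclideanLin A γ - (γ' - γ)) := by
    rw [applyGates_eq, map_sub, map_sub, LinearMap.sub_apply, LinearMap.sub_apply,
      toEuclideanLin_one_apply]
    abel
  have e1 := norm_toEuclideanLin_le (gateProd l - 1 - A) γ
  rw [hγ, mul_one] at e1
  have e2 : ‖γ' - γ‖ ^ 2 ≤ (d * Q) ^ 2 := by
    gcongr
    exact hγγ'.trans (le_mul_of_one_le_right hd0 hQ)
  rw [key]
  refine (norm_add_le _ _).trans ?_
  linarith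

/-- A discretized path of unit vectors of energy at most `η` can be followed by gates. The step errors
add up, since later gates are isometric, and the energy is `2`-Lipschitz on unit vectors. -/
theorem exists_gates_follow {N : ℕ} {Q ρ d η : ℝ} (hQ : 1 ≤ Q) {H : QOp n} (hH : ‖H‖ ≤ 1)
    (hgen : ∀ (A : QOp n) (B : ℝ), Aᴴ = -A → (∀ x y, ‖A x y‖ ≤ 3 * B) → Generates N (B * Q) ρ A)
    (hd0 : 0 ≤ d) (hd : d * Q ≤ 1) (γ : ℕ → QState n) (M : ℕ) (hγ : ∀ j ≤ M, ‖γ j‖ = 1)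
    (hE : ∀ j ≤ M, QState.energy H (γ j) ≤ η) (hγd : ∀ j < M, ‖γ (j + 1) - γ j‖ ≤ d) :
    ∃ l : List (QOp n), l.length ≤ M * N ∧ (∀ U ∈ l, IsGate U) ∧
      ‖QState.applyGates l (γ 0) - γ M‖ ≤ M * (2 * (d * Q) ^ 2) ∧
      ∀ l', l' <+: l → QState.energy H (QState.applyGates l' (γ 0)) ≤
        η + 2 * (ρ + d * Q + M * (2 * (d * Q) ^ 2)) := by
  -- The empty product, which equals the identity, is among those bounded by the drift.
  have hρ : 0 ≤ ρ := by
    obtain ⟨l, -, -, -, -, h⟩ := (hgen 0 0 (by simp) (by simp)).2 0 (by simp)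
    simpa using h [] l.nil_prefix
  induction M with
  | zero =>
    refine ⟨[], by simp, by simp, by simp [QState.applyGates], fun l' hl' => ?_⟩
    rw [List.prefix_nil.1 hl']
    have h := hE 0 le_rfl
    have h1 : 0 ≤ d * Q := by positivity
    simp only [QState.applyGates, List.foldl_nil, Nat.cast_zero, zero_mul, add_zero]
    linarith
  | succ M ih =>
    obtain ⟨l, h1, h2, h3, h4⟩ := ih (fun j hj => hγ j (by omega)) (fun j hj => hE j (by omega))
      fun j hj => hγd j (by omega)
    obtain ⟨m, m1, m2, m3, m4⟩ := exists_gates_step hQ hgen hd (hγ M (by omega))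
      (hγ (M + 1) le_rfl) (hγd M (by omega))
    have hsq : 0 ≤ 2 * (d * Q) ^ 2 := by positivity
    push_cast
    refine ⟨l ++ m, ?_, ?_, ?_, ?_⟩
    · rw [List.length_append, add_mul, one_mul]
      omega
    · intro U hU
      rcases List.mem_append.1 hU with h | h
      exacts [h2 U h, m2 U h]
    · rw [applyGates_append]
      have e := norm_applyGates_sub_applyGates m2 (QState.applyGates l (γ 0)) (γ M)
      have e' := norm_sub_le_norm_sub_add_norm_sub
        (QState.applyGates m (QState.applyGates l (γ 0))) (QState.applyGates m (γ M)) (γ (M + 1))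
      linarith
    · intro l' hl'
      rcases prefix_append_cases hl' with h | ⟨m', rfl, h⟩
      · linarith [h4 l' h]
      · rw [applyGates_append]
        set v := QState.applyGates l (γ 0)
        have hv : ‖v‖ = 1 := by rw [norm_applyGates h2, hγ 0 (by omega)]
        have hm' : ∀ U ∈ m', IsGate U := fun U hU => m2 U (h.subset hU)
        have e1 := norm_applyGates_sub_le hv (m4 m' h)
        have e2 := norm_sub_le_norm_sub_add_norm_sub (QState.applyGates m' v) v (γ M)
        have e3 := energy_le_add_two_mul_norm_sub hH (v := QState.applyGates m' v) (w := γ M)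
          (by rw [norm_applyGates hm', hv]) (hγ M (by omega))
        linarith [hE M (by omega)]

end Traversal

end

theorem mainTheorem1 :
    ∀ p : Polynomial ℕ, ∃ q : Polynomial ℕ,
      ∀ (n : ℕ) (H : QOp n), H.PosSemidef → (1 - H).PosSemidef →
      ∀ (η : ℝ) (ψ φ : QState n), ‖ψ‖ = 1 → ‖φ‖ = 1 →
        QState.energy H ψ ≤ η → QState.energy H φ ≤ η →
      ∀ Δ : ℝ, ((2 : ℝ) ^ (p.eval n))⁻¹ ≤ Δ →
        ∃ gates : List (QOp n),
          gates.length ≤ 2 ^ (q.eval n) ∧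
          (∀ U ∈ gates, QOp.IsLocalUnitary 2 U) ∧
          ‖QState.applyGates gates ψ - φ‖ ≤ Δ ∧
          ∀ i ∈ Finset.Icc 1 gates.length,
            QState.energy H (QState.applyGates (gates.take i) ψ) ≤ η + Δ := by
  intro p
  let X : Polynomial ℕ := Polynomial.X
  refine ⟨10 + p + 2 * (3 + 3 * X + X * (p + X + 4)) + 5 * X + 1, ?_⟩
  intro n H hH0 hH1 η ψ φ hψ hφ hEψ hEφ Δ hΔ
  set D := p.eval n
  -- The small angle is `2 ^ (-b)`, which keeps the drift of `n` conjugations below `δ / 8`. The cost of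
  -- a generator with entries of order one is `2 ^ κ`. The number of steps is `2 ^ m`: each has length at
  -- most `8 / 2 ^ m` and error at most `2 * (8 * 2 ^ κ / 2 ^ m) ^ 2`, so the errors add up to `δ / 8`.
  let b := D + n + 4
  let κ := 3 + 3 * n + n * b
  let m := 10 + D + 2 * κ
  set δ : ℝ := ((2 : ℝ) ^ D)⁻¹ with hδ
  have hδ0 : 0 < δ := by positivity
  have hgen : ∀ (A : QOp n) (B : ℝ), A.conjTranspose = -A → (∀ x y, ‖A x y‖ ≤ 3 * B) →
      Generates (4 ^ n * 8 ^ n) (B * 2 ^ κ) (δ / 8) A := by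
    intro A B hA hB
    have hB0 : 0 ≤ 3 * B := (norm_nonneg _).trans (hB 0 0)
    have hb : ((2 : ℝ) ^ b)⁻¹ ≤ 1 / 2 := by
      rw [one_div]
      refine inv_anti₀ two_pos ?_
      calc (2 : ℝ) = 2 ^ 1 := (pow_one _).symm
        _ ≤ 2 ^ b := pow_le_pow_right₀ one_le_two (by omega)
    refine (generates_skewHermitian (a := ((2 : ℝ) ^ b)⁻¹) (by positivity) hb hA hB).mono
      le_rfl ?_ ?_
    · have e4 : (4 : ℝ) ^ n = 2 ^ n * 2 ^ n := by rw [← mul_pow]; norm_num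
      have eb : (2 : ℝ) ^ κ = 8 * (2 ^ n * 2 ^ n * 2 ^ n) * (2 ^ b) ^ n := by
        rw [← pow_mul]
        have : κ = 3 + n + n + n + b * n := by simp only [κ]; ring
        rw [this]
        simp only [pow_add]
        ring
      rw [e4, eb, inv_inv]
      have : 0 ≤ B * ((2 ^ n * 2 ^ n * 2 ^ n) * (2 ^ b) ^ n) := by
        have : 0 ≤ B := by linarith
        positivity
      nlinarith
    · have hn : (n : ℝ) ≤ 2 ^ n := by exact_mod_cast Nat.lt_two_pow_self.le
      have : ((2 : ℝ) ^ b)⁻¹ = δ * (2 ^ n)⁻¹ / 16 := by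
        simp only [b, hδ, pow_add]
        field_simp
        norm_num
      rw [this]
      have h2 : (n : ℝ) * (2 ^ n)⁻¹ ≤ 1 := by
        rw [← div_eq_mul_inv]
        exact div_le_one_of_le₀ hn (by positivity)
      nlinarith
  obtain ⟨c, γ, hc, hγ0, hγ1, hγ⟩ := exists_lowEnergy_path hH0.1 hψ hφ hEψ hEφ
  have hM : (0 : ℝ) < 2 ^ m := by positivity
  have hmem : ∀ j : ℕ, j ≤ 2 ^ m → (j : ℝ) / 2 ^ m ∈ Set.Icc (0 : ℝ) 1 := fun j hj =>
    ⟨by positivity, div_le_one_of_le₀ (by exact_mod_cast hj) hM.le⟩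
  have hm : (2 : ℝ) ^ m = 1024 * 2 ^ D * (2 ^ κ * 2 ^ κ) := by
    simp only [m, pow_add, two_mul]
    norm_num
  have hQ : (1 : ℝ) ≤ 2 ^ κ := one_le_pow₀ one_le_two
  have hD : (1 : ℝ) ≤ 2 ^ D := one_le_pow₀ one_le_two
  have hdQ : (8 / 2 ^ m : ℝ) * 2 ^ κ = δ / 128 / 2 ^ κ := by
    rw [hm, hδ]
    field_simp
    norm_num
  have hdQ' : (8 / 2 ^ m : ℝ) * 2 ^ κ ≤ δ / 128 := by
    rw [hdQ]
    exact div_le_self (by positivity) hQ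
  have hδ1 : δ ≤ 1 := inv_le_one_of_one_le₀ hD
  have herr : ((2 ^ m : ℕ) : ℝ) * (2 * ((8 / 2 ^ m : ℝ) * 2 ^ κ) ^ 2) = δ / 8 := by
    push_cast
    rw [hdQ, hm, hδ]
    field_simp
    norm_num
  obtain ⟨l, l1, l2, l3, l4⟩ := exists_gates_follow (d := 8 / 2 ^ m) (η := η) hQ
    (norm_le_one_of_posSemidef hH0 hH1) hgen (by positivity) (by linarith)
    (fun j : ℕ => γ (j / 2 ^ m)) (2 ^ m)
    (fun j hj => (hγ _ (hmem j hj)).1) (fun j hj => (hγ _ (hmem j hj)).2.1) (fun j hj => by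
      refine ((hγ _ (hmem (j + 1) hj)).2.2 _ (hmem j hj.le)).trans (le_of_eq ?_)
      have : ((j + 1 : ℕ) : ℝ) / 2 ^ m - (j : ℝ) / 2 ^ m = 1 / 2 ^ m := by
        push_cast
        ring
      rw [this, abs_of_pos (by positivity)]
      ring)
  -- The first gate is the global phase that relates `ψ` to the start of the path.
  have hphase : QState.applyGates [c • (1 : QOp n)] ψ = γ 0 := by
    rw [hγ0, applyGates_eq, gateProd_singleton, map_smul, LinearMap.smul_apply,
      toEuclideanLin_one_apply]
  rw [herr] at l3 l4
  push_cast at l3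
  rw [div_self hM.ne', hγ1] at l3
  simp only [Nat.cast_zero, zero_div] at l3 l4
  refine ⟨[c • (1 : QOp n)] ++ l, ?_, ?_, ?_, ?_⟩
  · have e : (10 + p + 2 * (3 + 3 * X + X * (p + X + 4)) + 5 * X + 1).eval n = m + 5 * n + 1 := by
      simp [X, m, κ, b, D]
    have e' : 2 ^ m * (4 ^ n * 8 ^ n) = 2 ^ (m + 5 * n) := by
      rw [← mul_pow, pow_add 2 m, pow_mul 2 5 n]
      norm_num
    have h1 : 1 ≤ 2 ^ (m + 5 * n) := Nat.one_le_two_pow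
    rw [e, pow_succ, List.length_append, List.length_singleton]
    rw [e'] at l1
    omega
  · intro U hU
    rcases List.mem_append.1 hU with h | h
    · rw [List.mem_singleton.1 h]
      exact (isGate_phase hc).1
    · exact (l2 U h).1
  · rw [applyGates_append, hphase]
    linarith
  · intro i _
    rcases prefix_append_cases (List.take_prefix i ([c • (1 : QOp n)] ++ l)) with h | ⟨l', h, hl'⟩
    · rcases List.prefix_concat_iff (l₂ := []).1 h with h | h
      · rw [h, List.nil_append, hphase]
        linarith [l4 [] l.nil_prefix, (hγ 0 ⟨le_rfl, zero_le_one⟩).2.1]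
      · rw [List.prefix_nil.1 h]
        simp only [QState.applyGates, List.foldl_nil]
        linarith
    · rw [h, applyGates_append, hphase]
      linarith [l4 l' hl']
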